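/- Let $\tau=\frac{1+\sqrt5}{2}$ and let $\mathcal P$ be the regular icosahedron centred at the origin of $\mathbb R^3$ whose edges touch the unit sphere (at their midpoints); its vertices are the cyclic permutations of $(0,\pm\tau^{-1},\pm1)$. For $\delta\in[0,\pi/2]$ rotate the line containing each of the 30 edges of $\mathcal P$ by the angle $\delta$, counterclockwise as seen from the tip of the axis, about the axis through the origin and the midpoint of the edge. This gives a configuration of 30 lines tangent to the unit sphere (the lines of the edges of the icosahedron for $\delta=0$ and of the dual dodecahedron for $\delta=\pi/2$). Let $d(\delta)$ be the minimal distance between two of these lines that come from distinct edges. All complex roots of the polynomial $$5t^6-80t^5+190t^3-4t^2-84t+9$$ are real, and it has a root $t_0\approx 0.694356$ such that $d(\delta)$, $\delta\in[0,\pi/2]$, attains its maximum exactly at the angle $$\delta_{\max}=\arctan\left(\sqrt{t_0}\right)\approx 0.694707 .$$ The square of the minimal distance at this angle is $d(\delta_{\max})^2\approx 0.0429216$. The corresponding radius of cylinders is $$r_{\max}=\frac{d(\delta_{\max})}{2-d(\delta_{\max})}\approx 0.115558 ;$$ that is, $r_{\max}$ is the only $r>0$ for which the 30 infinite open right circular cylinders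 of radius $r$ that touch the unit sphere from the outside and whose rulings touching the sphere are the 30 lines at the angle $\delta_{\max}$ are pairwise disjoint while some two of them touch each other. In each approximation all the digits given are correct after rounding (the error is at most half a unit of the last digit). -/

import Mathlib

open Real Polynomial

noncomputable section

namespace PlatonicCompound

/-- Euclidean three-space. -/
abbrev E3 : Type := EuclideanSpace ℝ (Fin 3)

/-- The cross product on Euclidean three-space. -/
def cross (x y : E3) : E3 := WithLp.toLp 2 (crossProduct x.ofLp y.ofLp)

/-- The twelve vertices of the regular icosahedron centred at the origin with midradius 1:
the cyclic permutations of `(0, ±τ⁻¹, ±1)`, where `τ` is the golden ratio. -/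
def icosahedronVertices : Set E3 :=
  {x | ∃ s ∈ ({1, -1} : Set ℝ), ∃ t ∈ ({1, -1} : Set ℝ),
    x = !₂[0, s * goldenRatio⁻¹, t] ∨
    x = !₂[t, 0, s * goldenRatio⁻¹] ∨
    x = !₂[s * goldenRatio⁻¹, t, 0]}

/-- `(v, w)` are the end points of an edge of the icosahedron: two vertices at distance `2 / τ`,
which is the edge length (and the smallest distance between distinct vertices).
The thirty edges are the unordered pairs `s(v, w)`. -/
def IsEdge (e : E3 × E3) : Prop :=
  e.1 ∈ icosahedronVertices ∧ e.2 ∈ icosahedronVertices ∧ dist e.1 e.2 = 2 / goldenRatio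

/-- Two end-point pairs that belong to two distinct edges of the icosahedron. -/
def AreDistinctEdges (e e' : E3 × E3) : Prop :=
  IsEdge e ∧ IsEdge e' ∧ s(e.1, e.2) ≠ s(e'.1, e'.2)

/-- The middle of an edge; it is the point at which the edge touches the unit sphere. -/
def edgeMiddle (e : E3 × E3) : E3 := midpoint ℝ e.1 e.2

/-- The direction of an edge after the rotation by the angle `δ` about the axis through the origin
and the middle of the edge, counterclockwise as seen from the tip of the axis. The edge vector is
orthogonal to the unit vector `edgeMiddle e`, so that the rotation is given by this formula.
Interchanging the end points changes the sign of the direction only. -/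
def rotatedDirection (δ : ℝ) (e : E3 × E3) : E3 :=
  cos δ • (e.2 - e.1) + sin δ • cross (edgeMiddle e) (e.2 - e.1)

/-- The straight line through `p` with direction `u`. -/
def straightLine (p u : E3) : Set E3 := {x | ∃ t : ℝ, x = p + t • u}

/-- The tangent line to the unit sphere which the line of the edge `e` becomes after the rotation
by the angle `δ`. -/
def tangentLine (δ : ℝ) (e : E3 × E3) : Set E3 :=
  straightLine (edgeMiddle e) (rotatedDirection δ e)

/-- The distance between two nonempty sets (here: lines), the infimum of the distances between
their points. -/
def setDist (A B : Set E3) : ℝ := sInf {r | ∃ x ∈ A, ∃ y ∈ B, r = dist x y}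

/-- The minimal distance between two of the thirty lines at the angle `δ` (a minimum over finitely
many pairs of distinct edges). -/
def minDist (δ : ℝ) : ℝ :=
  sInf {d | ∃ e e', AreDistinctEdges e e' ∧ d = setDist (tangentLine δ e) (tangentLine δ e')}

/-- The axis of the right circular cylinder of radius `r` that touches the unit ball from the
outside and whose ruling touching the unit sphere is `tangentLine δ e`. -/
def cylinderAxis (r δ : ℝ) (e : E3 × E3) : Set E3 :=
  straightLine ((1 + r) • edgeMiddle e) (rotatedDirection δ e)

/-- The infinite open right circular cylinder with that axis and radius `r`. -/
def openCylinder (r δ : ℝ) (e : E3 × E3) : Set E3 :=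
  {x | Metric.infDist x (cylinderAxis r δ e) < r}

/-- The infinite closed right circular cylinder with that axis and radius `r`. -/
def closedCylinder (r δ : ℝ) (e : E3 × E3) : Set E3 :=
  {x | Metric.infDist x (cylinderAxis r δ e) ≤ r}

/-- The thirty congruent cylinders of radius `r` over the lines at the angle `δ` form a compound:
the open cylinders do not intersect and some of the cylinders touch each other. -/
def IsCompoundRadius (δ r : ℝ) : Prop :=
  0 < r ∧
  (∀ e e', AreDistinctEdges e e' → Disjoint (openCylinder r δ e) (openCylinder r δ e')) ∧
  (∃ e e', AreDistinctEdges e e' ∧ (closedCylinder r δ e ∩ closedCylinder r δ e').Nonempty)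

/-- The polynomial `5t⁶ - 80t⁵ + 190t³ - 4t² - 84t + 9`. -/
def criticalPoly : ℤ[X] := 5 * X ^ 6 - 80 * X ^ 5 + 190 * X ^ 3 - 4 * X ^ 2 - 84 * X + 9

end PlatonicCompound

end

/-!
Write `m` for the middle of an edge, `a` for its unit direction and `b = m × a`. The rotated
direction is `cos δ • a + sin δ • b`, and for two edges the distance of the rotated lines is the
component of `m' - m` along the common normal. Since the derivative of the direction with respect
to `δ` is `m × (cos δ • a + sin δ • b)`, only the three numbers `α = a·a'`, `β = b·b'` and
`σ = a·b' + b·a'` enter: with `T = tan δ` the square of the distance is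
`(σ (1 - T²) + 2 (β - α) T)² / ((1 + T²)² - (α + β T² + σ T)²)` (`HasProducts.setDist_sq_eq`).
Up to a common sign, eleven triples `(α, β, σ)` occur (`AreDistinctEdges.exists_hasProducts`).

Two of them decide. With `t = T²`, orthogonal edges with orthogonal middles give
`(1 - t)² / (1 + t + t²)` (`orthogonalDistSq`), an increasing function of `t + 1 / t`. Two edges of
a face give a multiple of the reciprocal of `(4 - τ⁻²) t + (8 - 2 τ⁻¹) + 3 / t` (`adjacentDistSq`).
The two agree at the root `t₀` of a cubic over `ℚ(√5)` which divides the critical polynomial; the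
product of the cubic and its conjugate is that polynomial. The second function is smaller than at
`t₀` for `t < t₀` and for `t ≥ 1 / t₀`, the first one for `t₀ < t < 1 / t₀` (`minDist_sq_lt`). At
`t₀` the other nine triples give larger distances (`productTable_bound`, `minDist_arctan`), so that
`t₀` is the unique maximum.

The axes of the cylinders of radius `r` are the lines scaled by `1 + r`; their smallest distance is
`(1 + r) d`, and the cylinders form a compound exactly when this is `2 r` (`isCompoundRadius_iff`).
The critical polynomial changes its sign six times on the real line, so it has no other roots.
-/

noncomputable section

namespace PlatonicCompound

/-! ### Lines in space -/

theorem inner_eq_coord (x y : E3) :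
    inner ℝ x y = x 0 * y 0 + x 1 * y 1 + x 2 * y 2 := by
  simp only [PiLp.inner_apply, Fin.sum_univ_three, RCLike.inner_apply, conj_trivial]
  ring

theorem norm_sq_eq_coord (x : E3) : ‖x‖ ^ 2 = x 0 ^ 2 + x 1 ^ 2 + x 2 ^ 2 := by
  rw [← real_inner_self_eq_norm_sq, inner_eq_coord]
  ring

theorem cross_coord_zero (x y : E3) : cross x y 0 = x 1 * y 2 - x 2 * y 1 := by
  simp [cross, crossProduct]

theorem cross_coord_one (x y : E3) : cross x y 1 = x 2 * y 0 - x 0 * y 2 := by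
  simp [cross, crossProduct]

theorem cross_coord_two (x y : E3) : cross x y 2 = x 0 * y 1 - x 1 * y 0 := by
  simp [cross, crossProduct]

theorem norm_sq_cross (x y : E3) :
    ‖cross x y‖ ^ 2 = ‖x‖ ^ 2 * ‖y‖ ^ 2 - inner ℝ x y ^ 2 := by
  simp only [norm_sq_eq_coord, inner_eq_coord, cross_coord_zero, cross_coord_one, cross_coord_two]
  ring

theorem inner_cross_left (x y : E3) : inner ℝ (cross x y) x = 0 := by
  simp only [inner_eq_coord, cross_coord_zero, cross_coord_one, cross_coord_two]
  ring

theorem inner_cross_right (x y : E3) : inner ℝ (cross x y) y = 0 := by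
  simp only [inner_eq_coord, cross_coord_zero, cross_coord_one, cross_coord_two]
  ring

/-- The expansion of a vector `w` in the basis `x, y, x × y`. -/
theorem norm_sq_cross_smul (x y w : E3) :
    ‖cross x y‖ ^ 2 • w = inner ℝ (cross x y) w • cross x y
      + inner ℝ (cross w y) (cross x y) • x - inner ℝ (cross w x) (cross x y) • y := by
  ext i
  fin_cases i <;>
  · simp [norm_sq_eq_coord, inner_eq_coord, cross_coord_zero, cross_coord_one, cross_coord_two]
    ring

theorem setDist_nonneg (A B : Set E3) : 0 ≤ setDist A B := by
  refine Real.sInf_nonneg ?_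
  rintro _ ⟨x, -, y, -, rfl⟩
  exact dist_nonneg

theorem setDist_le_dist {A B : Set E3} {x y : E3} (hx : x ∈ A) (hy : y ∈ B) :
    setDist A B ≤ dist x y :=
  csInf_le ⟨0, by rintro _ ⟨x, -, y, -, rfl⟩; exact dist_nonneg⟩ ⟨x, hx, y, hy, rfl⟩

/-- Every difference of points of two lines has the same component along the common normal. -/
theorem abs_inner_le_dist {p q u v x y : E3} (hx : x ∈ straightLine p u)
    (hy : y ∈ straightLine q v) :
    |inner ℝ (cross u v) (q - p)| ≤ ‖cross u v‖ * dist x y := by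
  obtain ⟨a, rfl⟩ := hx
  obtain ⟨b, rfl⟩ := hy
  have h : inner ℝ (cross u v) (q - p) =
      inner ℝ (cross u v) ((q + b • v) - (p + a • u)) := by
    have e : (q + b • v) - (p + a • u) = (q - p) + b • v - a • u := by abel
    rw [e, inner_sub_right (cross u v) _ (a • u), inner_add_right, inner_smul_right,
      inner_smul_right, inner_cross_left, inner_cross_right]
    ring
  rw [h, dist_comm, dist_eq_norm]
  exact abs_real_inner_le_norm _ _

/-- Two nonparallel lines have a common perpendicular. -/
theorem exists_dist_eq {p q u v : E3} (h : cross u v ≠ 0) :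
    ∃ x ∈ straightLine p u, ∃ y ∈ straightLine q v,
      dist x y = |inner ℝ (cross u v) (q - p)| / ‖cross u v‖ := by
  have hn : ‖cross u v‖ ≠ 0 := norm_ne_zero_iff.2 h
  set n := cross u v with hndef
  refine ⟨_, ⟨inner ℝ (cross (q - p) v) n / ‖n‖ ^ 2, rfl⟩,
    _, ⟨inner ℝ (cross (q - p) u) n / ‖n‖ ^ 2, rfl⟩, ?_⟩
  have key := norm_sq_cross_smul u v (q - p)
  rw [← hndef] at key
  have e : (q + (inner ℝ (cross (q - p) u) n / ‖n‖ ^ 2) • v)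
      - (p + (inner ℝ (cross (q - p) v) n / ‖n‖ ^ 2) • u)
      = (inner ℝ n (q - p) / ‖n‖ ^ 2) • n := by
    have : q - p = (‖n‖ ^ 2)⁻¹ • (inner ℝ n (q - p) • n
        + inner ℝ (cross (q - p) v) n • u - inner ℝ (cross (q - p) u) n • v) := by
      rw [← key, smul_smul, inv_mul_cancel₀ (pow_ne_zero 2 hn), one_smul]
    have e' : ∀ a b : ℝ, (q + a • v) - (p + b • u) = (q - p) + (a • v - b • u) := by
      intro a b; abel
    rw [e']
    conv_lhs => arg 1; rw [this]
    simp only [div_eq_inv_mul, smul_add, smul_sub, smul_smul]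
    abel
  rw [dist_comm, dist_eq_norm, e, norm_smul, Real.norm_eq_abs, abs_div,
    abs_of_nonneg (sq_nonneg ‖n‖)]
  field_simp

theorem setDist_straightLine {p q u v : E3} (h : cross u v ≠ 0) :
    setDist (straightLine p u) (straightLine q v)
      = |inner ℝ (cross u v) (q - p)| / ‖cross u v‖ := by
  apply le_antisymm
  · obtain ⟨x, hx, y, hy, hxy⟩ := exists_dist_eq (p := p) (q := q) h
    exact hxy ▸ setDist_le_dist hx hy
  · obtain ⟨x, hx, y, hy, hxy⟩ := exists_dist_eq (p := p) (q := q) h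
    refine le_csInf ⟨_, x, hx, y, hy, rfl⟩ ?_
    rintro _ ⟨x, hx, y, hy, rfl⟩
    rw [div_le_iff₀ (norm_pos_iff.2 h), mul_comm]
    exact abs_inner_le_dist hx hy

theorem exists_dist_eq_setDist {p q u v : E3} (h : cross u v ≠ 0) :
    ∃ x ∈ straightLine p u, ∃ y ∈ straightLine q v,
      dist x y = setDist (straightLine p u) (straightLine q v) := by
  rw [setDist_straightLine h]
  exact exists_dist_eq h

/-! ### The frame of an edge -/

theorem inv_goldenRatio_sq : goldenRatio⁻¹ ^ 2 = 1 - goldenRatio⁻¹ := by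
  rw [inv_goldenRatio]
  linear_combination goldenConj_sq

theorem inv_goldenRatio_pos : 0 < goldenRatio⁻¹ := inv_pos.2 goldenRatio_pos

theorem norm_sq_of_mem_icosahedronVertices {x : E3} (hx : x ∈ icosahedronVertices) :
    ‖x‖ ^ 2 = 1 + goldenRatio⁻¹ ^ 2 := by
  obtain ⟨s, hs, t, ht, h⟩ := hx
  have hs2 : s ^ 2 = 1 := by rcases hs with rfl | rfl <;> norm_num
  have ht2 : t ^ 2 = 1 := by rcases ht with rfl | rfl <;> norm_num
  rcases h with rfl | rfl | rfl <;> simp [norm_sq_eq_coord, mul_pow, hs2, ht2, add_comm]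

theorem edgeMiddle_coord (e : E3 × E3) (i : Fin 3) : edgeMiddle e i = (e.1 i + e.2 i) / 2 := by
  simp [edgeMiddle, midpoint_eq_smul_add]
  ring

theorem IsEdge.norm_sq_sub {e : E3 × E3} (h : IsEdge e) :
    ‖e.2 - e.1‖ ^ 2 = 4 * goldenRatio⁻¹ ^ 2 := by
  rw [← dist_eq_norm, dist_comm, h.2.2]
  ring

theorem IsEdge.inner_edgeMiddle {e : E3 × E3} (h : IsEdge e) :
    inner ℝ (edgeMiddle e) (e.2 - e.1) = 0 := by
  have h1 := norm_sq_of_mem_icosahedronVertices h.1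
  have h2 := norm_sq_of_mem_icosahedronVertices h.2.1
  simp only [norm_sq_eq_coord, inner_eq_coord, edgeMiddle_coord, PiLp.sub_apply] at *
  linear_combination (h2 - h1) / 2

theorem IsEdge.norm_sq_edgeMiddle {e : E3 × E3} (h : IsEdge e) : ‖edgeMiddle e‖ ^ 2 = 1 := by
  have h1 := norm_sq_of_mem_icosahedronVertices h.1
  have h2 := norm_sq_of_mem_icosahedronVertices h.2.1
  have h3 := h.norm_sq_sub
  simp only [norm_sq_eq_coord, edgeMiddle_coord, PiLp.sub_apply] at *
  linear_combination (h2 + h1) / 2 - h3 / 4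

/-- The direction of the edge at the angle `π / 2`. -/
def turned (e : E3 × E3) : E3 := cross (edgeMiddle e) (e.2 - e.1)

theorem rotatedDirection_coord (δ : ℝ) (e : E3 × E3) (i : Fin 3) :
    rotatedDirection δ e i = cos δ * (e.2 - e.1) i + sin δ * turned e i := by
  simp [rotatedDirection, turned]

theorem IsEdge.cross_turned {e : E3 × E3} (h : IsEdge e) :
    cross (turned e) (edgeMiddle e) = e.2 - e.1 := by
  have h1 := h.inner_edgeMiddle
  have h2 := h.norm_sq_edgeMiddle
  generalize hv : e.2 - e.1 = v at *
  generalize hm : edgeMiddle e = m at *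
  rw [norm_sq_eq_coord] at h2
  rw [inner_eq_coord] at h1
  ext i
  fin_cases i <;>
    simp only [turned, cross_coord_zero, cross_coord_one, cross_coord_two, hv, hm, Fin.zero_eta,
      Fin.mk_one, Fin.reduceFinMk]
  · linear_combination v 0 * h2 - m 0 * h1
  · linear_combination v 1 * h2 - m 1 * h1
  · linear_combination v 2 * h2 - m 2 * h1

theorem IsEdge.norm_sq_turned {e : E3 × E3} (h : IsEdge e) :
    ‖turned e‖ ^ 2 = 4 * goldenRatio⁻¹ ^ 2 := by
  rw [turned, norm_sq_cross, h.inner_edgeMiddle, h.norm_sq_edgeMiddle, h.norm_sq_sub]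
  ring

theorem IsEdge.norm_sq_rotatedDirection {e : E3 × E3} (h : IsEdge e) (δ : ℝ) :
    ‖rotatedDirection δ e‖ ^ 2 = 4 * goldenRatio⁻¹ ^ 2 := by
  have h0 : inner ℝ (turned e) (e.2 - e.1) = 0 := inner_cross_right _ _
  have h1 := h.norm_sq_turned
  have h2 := h.norm_sq_sub
  have h3 := Real.sin_sq_add_cos_sq δ
  simp only [norm_sq_eq_coord, inner_eq_coord, rotatedDirection_coord] at *
  linear_combination 2 * cos δ * sin δ * h0 + sin δ ^ 2 * h1 + cos δ ^ 2 * h2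
    + 4 * goldenRatio⁻¹ ^ 2 * h3

/-- The three scalar products of the edge frames on which the distance of the rotated edges
depends: of the edge directions, of the turned directions, and the sum of the mixed ones. They are
divided by the square `4 τ⁻²` of the edge length. -/
structure HasProducts (e e' : E3 × E3) (α β σ : ℝ) : Prop where
  inner_edge : inner ℝ (e.2 - e.1) (e'.2 - e'.1) = 4 * goldenRatio⁻¹ ^ 2 * α
  inner_turned : inner ℝ (turned e) (turned e') = 4 * goldenRatio⁻¹ ^ 2 * β
  inner_mixed : inner ℝ (e.2 - e.1) (turned e') + inner ℝ (turned e) (e'.2 - e'.1)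
    = 4 * goldenRatio⁻¹ ^ 2 * σ

/-- The square of the sine of the angle between the two rotated edges. -/
def sinSqAngle (α β σ δ : ℝ) : ℝ :=
  1 - (α * cos δ ^ 2 + β * sin δ ^ 2 + σ * (cos δ * sin δ)) ^ 2

/-- The volume of the parallelepiped spanned by the unit directions of the two rotated edges
and the difference of the edge middles, up to the sign. -/
def mixedVolume (α β σ δ : ℝ) : ℝ :=
  σ * (cos δ ^ 2 - sin δ ^ 2) + 2 * (β - α) * (cos δ * sin δ)

theorem HasProducts.norm_sq_cross {e e' : E3 × E3} {α β σ : ℝ} (H : HasProducts e e' α β σ)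
    (h : IsEdge e) (h' : IsEdge e') (δ : ℝ) :
    ‖cross (rotatedDirection δ e) (rotatedDirection δ e')‖ ^ 2
      = 16 * goldenRatio⁻¹ ^ 4 * sinSqAngle α β σ δ := by
  rw [PlatonicCompound.norm_sq_cross, h.norm_sq_rotatedDirection, h'.norm_sq_rotatedDirection]
  have : inner ℝ (rotatedDirection δ e) (rotatedDirection δ e') = 4 * goldenRatio⁻¹ ^ 2 *
      (α * cos δ ^ 2 + β * sin δ ^ 2 + σ * (cos δ * sin δ)) := by
    obtain ⟨h1, h2, h3⟩ := H
    simp only [inner_eq_coord, rotatedDirection_coord] at *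
    linear_combination cos δ ^ 2 * h1 + sin δ ^ 2 * h2 + cos δ * sin δ * h3
  rw [this, sinSqAngle]
  ring

theorem inner_cross_rotatedDirection {e e' : E3 × E3} (h : IsEdge e) (h' : IsEdge e') (δ : ℝ) :
    inner ℝ (cross (rotatedDirection δ e) (rotatedDirection δ e')) (edgeMiddle e' - edgeMiddle e)
      = - ((inner ℝ (e.2 - e.1) (turned e') + inner ℝ (turned e) (e'.2 - e'.1))
          * (cos δ ^ 2 - sin δ ^ 2)
        + 2 * (inner ℝ (turned e) (turned e') - inner ℝ (e.2 - e.1) (e'.2 - e'.1))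
          * (cos δ * sin δ)) := by
  -- the derivative of the direction in `δ` is `m × u`
  have D : ∀ e, IsEdge e → cross (edgeMiddle e) (rotatedDirection δ e)
      = cos δ • turned e - sin δ • (e.2 - e.1) := by
    intro e h
    have h1 := h.cross_turned
    ext i
    have h2 := congrArg (fun x : E3 => x i) h1
    have h3 : turned e i = cross (edgeMiddle e) (e.2 - e.1) i := rfl
    fin_cases i <;>
      simp only [Fin.zero_eta, Fin.mk_one, Fin.reduceFinMk, cross_coord_zero, cross_coord_one,
        cross_coord_two, rotatedDirection_coord, PiLp.sub_apply, PiLp.smul_apply,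
        smul_eq_mul] at * <;>
      linear_combination -cos δ * h3 - sin δ * h2
  have T : inner ℝ (cross (rotatedDirection δ e) (rotatedDirection δ e'))
        (edgeMiddle e' - edgeMiddle e)
      = - inner ℝ (rotatedDirection δ e) (cross (edgeMiddle e') (rotatedDirection δ e'))
        - inner ℝ (cross (edgeMiddle e) (rotatedDirection δ e)) (rotatedDirection δ e') := by
    simp only [inner_eq_coord, cross_coord_zero, cross_coord_one, cross_coord_two,
      PiLp.sub_apply]
    ring
  rw [T, D e h, D e' h']
  simp only [inner_eq_coord, rotatedDirection_coord, PiLp.sub_apply, PiLp.smul_apply, smul_eq_mul]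
  ring

theorem HasProducts.inner_sq {e e' : E3 × E3} {α β σ : ℝ} (H : HasProducts e e' α β σ)
    (h : IsEdge e) (h' : IsEdge e') (δ : ℝ) :
    inner ℝ (cross (rotatedDirection δ e) (rotatedDirection δ e'))
      (edgeMiddle e' - edgeMiddle e) ^ 2 = 16 * goldenRatio⁻¹ ^ 4 * mixedVolume α β σ δ ^ 2 := by
  rw [inner_cross_rotatedDirection h h', H.inner_edge, H.inner_turned, H.inner_mixed, mixedVolume]
  ring

theorem HasProducts.cross_ne_zero {e e' : E3 × E3} {α β σ : ℝ} (H : HasProducts e e' α β σ)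
    (h : IsEdge e) (h' : IsEdge e') {δ : ℝ} (hpos : 0 < sinSqAngle α β σ δ) :
    cross (rotatedDirection δ e) (rotatedDirection δ e') ≠ 0 := by
  intro h0
  have := H.norm_sq_cross h h' δ
  rw [h0, norm_zero] at this
  have hg := inv_goldenRatio_pos
  have : 0 < 16 * goldenRatio⁻¹ ^ 4 * sinSqAngle α β σ δ := by positivity
  linarith

/-- The square of the distance between two rotated edge lines. -/
theorem HasProducts.setDist_sq {e e' : E3 × E3} {α β σ : ℝ} (H : HasProducts e e' α β σ)
    (h : IsEdge e) (h' : IsEdge e') {δ : ℝ} (hpos : 0 < sinSqAngle α β σ δ) :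
    setDist (tangentLine δ e) (tangentLine δ e') ^ 2
      = mixedVolume α β σ δ ^ 2 / sinSqAngle α β σ δ := by
  have hg := inv_goldenRatio_pos
  rw [tangentLine, tangentLine, setDist_straightLine (H.cross_ne_zero h h' hpos), div_pow, sq_abs,
    H.norm_sq_cross h h', H.inner_sq h h']
  exact mul_div_mul_left _ _ (by positivity)

/-! ### The pairs of edges in exact arithmetic -/

/-- The embedding of `ℤ[√5]` into the real numbers. -/
def real5 : ℤ√5 →+* ℝ := Zsqrtd.toReal (by norm_num)

theorem real5_mk (a b : ℤ) : real5 ⟨a, b⟩ = a + b * √5 := by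
  simp [real5, Zsqrtd.toReal_apply]

theorem real5_injective : Function.Injective real5 := by
  refine Zsqrtd.toReal_injective _ fun n h => ?_
  have h1 : n ≤ 2 := by nlinarith
  have h2 : -2 ≤ n := by nlinarith
  interval_cases n <;> omega

/-- Triples with entries in `ℤ[√5]`. -/
abbrev Triple : Type := (ℤ√5) × (ℤ√5) × (ℤ√5)

namespace Triple

/-- The point of space with half of the coordinates `x`; half, because `2 τ⁻¹ = √5 - 1`. -/
def half (x : Triple) : E3 :=
  !₂[real5 x.1 / 2, real5 x.2.1 / 2, real5 x.2.2 / 2]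

/-- The scalar product. -/
def dot (x y : Triple) : ℤ√5 := x.1 * y.1 + x.2.1 * y.2.1 + x.2.2 * y.2.2

/-- The vector product. -/
def vec (x y : Triple) : Triple :=
  (x.2.1 * y.2.2 - x.2.2 * y.2.1, x.2.2 * y.1 - x.1 * y.2.2, x.1 * y.2.1 - x.2.1 * y.1)

end Triple

open Triple

/-- The vertices of the icosahedron with all coordinates doubled. -/
def doubledVertices : List Triple :=
  [1, -1].flatMap fun s => [2, -2].flatMap fun t =>
    [(0, s * ⟨-1, 1⟩, t), (t, 0, s * ⟨-1, 1⟩), (s * ⟨-1, 1⟩, t, 0)]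

/-- The edges of the doubled icosahedron; `24 - 8 √5 = (4 τ⁻¹)²` is the square of their length. -/
def doubledEdges : List (Triple × Triple) :=
  (doubledVertices ×ˢ doubledVertices).filter fun d => dot (d.2 - d.1) (d.2 - d.1) = ⟨24, -8⟩

/-- The possible values, up to a common sign, of `(4α, 4β, 4σ)` for the products `α`, `β`, `σ` of
two distinct edges in the sense of `HasProducts`. -/
def productTable : List Triple :=
  [(0, 0, 4), (2, ⟨-1, 1⟩, 0),
    (4, -4, 0), (⟨1, 1⟩, 2, ⟨-2, 2⟩), (⟨1, 1⟩, 2, ⟨2, -2⟩), (⟨1, 1⟩, -2, 0),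
    (2, ⟨1, -1⟩, ⟨2, 2⟩), (2, ⟨1, -1⟩, ⟨-2, -2⟩), (⟨-1, 1⟩, ⟨1, 1⟩, 0),
    (⟨-1, 1⟩, ⟨-1, -1⟩, 4), (⟨-1, 1⟩, ⟨-1, -1⟩, -4)]

/-- Eight times the vector `turned` of the edge of which `d` is the double: the sum `d.1 + d.2` is
four times the edge middle, and `d.2 - d.1` twice the edge vector. -/
def turnedTriple (d : Triple × Triple) : Triple := vec (d.1 + d.2) (d.2 - d.1)

/-- The edges with doubles `d` and `d'` have the products `r / 4` in the sense of `HasProducts`;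
the equations are multiplied by common denominators. -/
def Matches (d d' : Triple × Triple) (r : Triple) : Prop :=
  4 * dot (d.2 - d.1) (d'.2 - d'.1) = ⟨24, -8⟩ * r.1 ∧
  dot (turnedTriple d) (turnedTriple d') = ⟨96, -32⟩ * r.2.1 ∧
  dot (d.2 - d.1) (turnedTriple d') + dot (turnedTriple d) (d'.2 - d'.1) = ⟨24, -8⟩ * r.2.2

instance (d d' : Triple × Triple) (r : Triple) : Decidable (Matches d d' r) :=
  inferInstanceAs (Decidable (_ ∧ _ ∧ _))

/-- One orientation of each doubled edge, singled out by a linear functional without zeros on the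
edge directions. -/
def orientedEdges : List (Triple × Triple) :=
  doubledEdges.filter fun d =>
    0 < (d.2 - d.1).1.re + 4 * (d.2 - d.1).2.1.re + 16 * (d.2 - d.1).2.2.re

theorem mem_orientedEdges_or_swap_mem :
    ∀ d ∈ doubledEdges, d ∈ orientedEdges ∨ d.swap ∈ orientedEdges := by
  decide +kernel

/-- The enumeration of all pairs of edges, by exact computation in `ℤ[√5]`. -/
theorem exists_matches : ∀ d ∈ orientedEdges, ∀ d' ∈ orientedEdges, d = d' ∨
    ∃ r ∈ productTable, Matches d d' r ∨ Matches d d' (-r) := by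
  decide +kernel

theorem inv_goldenRatio_eq_sqrt : goldenRatio⁻¹ = (√5 - 1) / 2 := by
  rw [inv_goldenRatio, goldenConj]
  ring

theorem half_coord_zero (x : Triple) : half x 0 = real5 x.1 / 2 := rfl

theorem half_coord_one (x : Triple) : half x 1 = real5 x.2.1 / 2 := rfl

theorem half_coord_two (x : Triple) : half x 2 = real5 x.2.2 / 2 := rfl

theorem exists_mem_doubledVertices {x : E3} (hx : x ∈ icosahedronVertices) :
    ∃ p ∈ doubledVertices, x = half p := by
  obtain ⟨s, hs, t, ht, h⟩ := hx
  have key : ∀ (s t : ℤ√5), s ∈ [1, -1] → t ∈ [2, -2] → ∀ x : E3,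
      (x = !₂[0, real5 s * goldenRatio⁻¹, real5 t / 2] ∨
        x = !₂[real5 t / 2, 0, real5 s * goldenRatio⁻¹] ∨
        x = !₂[real5 s * goldenRatio⁻¹, real5 t / 2, 0]) → ∃ p ∈ doubledVertices, x = half p := by
    intro s t hs ht x hx
    have hmem : ∀ p ∈ [(0, s * ⟨-1, 1⟩, t), (t, 0, s * ⟨-1, 1⟩), (s * ⟨-1, 1⟩, t, 0)],
        p ∈ doubledVertices := fun p hp =>
      List.mem_flatMap.2 ⟨s, hs, List.mem_flatMap.2 ⟨t, ht, hp⟩⟩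
    have hg : real5 s * goldenRatio⁻¹ = real5 (s * ⟨-1, 1⟩) / 2 := by
      rw [map_mul, real5_mk (-1) 1, inv_goldenRatio_eq_sqrt]
      push_cast
      ring
    rcases hx with rfl | rfl | rfl
    · exact ⟨_, hmem (0, s * ⟨-1, 1⟩, t) (by simp), by simp only [half, hg, map_zero, zero_div]⟩
    · exact ⟨_, hmem (t, 0, s * ⟨-1, 1⟩) (by simp), by simp only [half, hg, map_zero, zero_div]⟩
    · exact ⟨_, hmem (s * ⟨-1, 1⟩, t, 0) (by simp), by simp only [half, hg, map_zero, zero_div]⟩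
  have hs' : ∃ s' ∈ ([1, -1] : List (ℤ√5)), real5 s' = s := by
    rcases hs with rfl | rfl
    · exact ⟨1, by simp, by simp⟩
    · exact ⟨-1, by simp, by simp⟩
  have ht' : ∃ t' ∈ ([2, -2] : List (ℤ√5)), real5 t' / 2 = t := by
    rcases ht with rfl | rfl
    · exact ⟨2, by simp, by simp only [map_ofNat]; norm_num⟩
    · exact ⟨-2, by simp, by simp only [map_neg, map_ofNat]; norm_num⟩
  obtain ⟨s', hs', rfl⟩ := hs'
  obtain ⟨t', ht', rfl⟩ := ht'
  exact key s' t' hs' ht' x h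

theorem real5_dot (x y : Triple) :
    real5 (dot x y) = real5 x.1 * real5 y.1 + real5 x.2.1 * real5 y.2.1
      + real5 x.2.2 * real5 y.2.2 := by
  simp [dot]

theorem IsEdge.exists_mem_doubledEdges {e : E3 × E3} (h : IsEdge e) :
    ∃ d ∈ doubledEdges, e = (half d.1, half d.2) := by
  obtain ⟨p, hp, h1⟩ := exists_mem_doubledVertices h.1
  obtain ⟨q, hq, h2⟩ := exists_mem_doubledVertices h.2.1
  refine ⟨(p, q), List.mem_filter.2 ⟨List.mem_product.2 ⟨hp, hq⟩, ?_⟩, Prod.ext h1 h2⟩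
  have h3 := h.norm_sq_sub
  rw [h1, h2, norm_sq_eq_coord] at h3
  simp only [PiLp.sub_apply, half_coord_zero, half_coord_one, half_coord_two] at h3
  rw [decide_eq_true_iff]
  apply real5_injective
  rw [real5_dot, real5_mk 24]
  simp only [Prod.fst_sub, Prod.snd_sub, map_sub]
  rw [inv_goldenRatio_eq_sqrt] at h3
  have h5 : √5 ^ 2 = 5 := Real.sq_sqrt (by norm_num)
  push_cast
  linear_combination 4 * h3 + 4 * h5

theorem hasProducts_of_matches {d d' : Triple × Triple} {r : Triple} (h : Matches d d' r) :
    HasProducts (half d.1, half d.2) (half d'.1, half d'.2)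
      (real5 r.1 / 4) (real5 r.2.1 / 4) (real5 r.2.2 / 4) := by
  obtain ⟨h1, h2, h3⟩ := h
  have h5 : √5 ^ 2 = 5 := Real.sq_sqrt (by norm_num)
  apply_fun real5 at h1 h2 h3
  simp only [map_mul, map_add, real5_mk 24, real5_mk 96, real5_dot, map_ofNat, turnedTriple, vec,
    Prod.fst_sub, Prod.snd_sub, Prod.fst_add, Prod.snd_add, map_sub] at h1 h2 h3
  push_cast at h1 h2 h3
  constructor <;>
    simp only [inner_eq_coord, turned, cross_coord_zero, cross_coord_one, cross_coord_two,
      edgeMiddle_coord, PiLp.sub_apply, half_coord_zero, half_coord_one, half_coord_two] <;>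
    rw [inv_goldenRatio_eq_sqrt]
  · linear_combination h1 / 16 - real5 r.1 / 4 * h5
  · linear_combination h2 / 64 - real5 r.2.1 / 4 * h5
  · linear_combination h3 / 16 - real5 r.2.2 / 4 * h5

theorem turned_swap (e : E3 × E3) : turned e.swap = - turned e := by
  ext i
  fin_cases i <;>
    simp [turned, cross_coord_zero, cross_coord_one, cross_coord_two, edgeMiddle_coord] <;> ring

theorem HasProducts.swap_left {e e' : E3 × E3} {α β σ : ℝ} (H : HasProducts e e' α β σ) :
    HasProducts e.swap e' (-α) (-β) (-σ) := by
  obtain ⟨h1, h2, h3⟩ := H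
  have h0 : e.swap.2 - e.swap.1 = -(e.2 - e.1) := by simp
  constructor
  · rw [h0, inner_neg_left, h1]; ring
  · rw [turned_swap, inner_neg_left, h2]; ring
  · rw [h0, turned_swap, inner_neg_left, inner_neg_left]; linear_combination -h3

theorem HasProducts.swap_right {e e' : E3 × E3} {α β σ : ℝ} (H : HasProducts e e' α β σ) :
    HasProducts e e'.swap (-α) (-β) (-σ) := by
  obtain ⟨h1, h2, h3⟩ := H
  have h0 : e'.swap.2 - e'.swap.1 = -(e'.2 - e'.1) := by simp
  constructor
  · rw [h0, inner_neg_right, h1]; ring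
  · rw [turned_swap, inner_neg_right, h2]; ring
  · rw [h0, turned_swap, inner_neg_right, inner_neg_right]; linear_combination -h3

/-- The products of two distinct edges are, up to a common sign, listed in `productTable`. -/
theorem AreDistinctEdges.exists_hasProducts {e e' : E3 × E3} (h : AreDistinctEdges e e') :
    ∃ r ∈ productTable, ∃ ε : ℝ, ε ^ 2 = 1 ∧ HasProducts e e' (ε * (real5 r.1 / 4))
      (ε * (real5 r.2.1 / 4)) (ε * (real5 r.2.2 / 4)) := by
  obtain ⟨he, he', hne⟩ := h
  have oriented : ∀ e, IsEdge e → ∃ d ∈ orientedEdges,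
      e = (half d.1, half d.2) ∨ e = (half d.2, half d.1) := by
    intro e he
    obtain ⟨d, hd, rfl⟩ := he.exists_mem_doubledEdges
    rcases mem_orientedEdges_or_swap_mem d hd with h | h
    · exact ⟨d, h, Or.inl rfl⟩
    · exact ⟨d.swap, h, Or.inr rfl⟩
  obtain ⟨d, hd, hed⟩ := oriented e he
  obtain ⟨d', hd', hed'⟩ := oriented e' he'
  have base : ∃ r ∈ productTable, ∃ ε : ℝ, ε ^ 2 = 1 ∧
      HasProducts (half d.1, half d.2) (half d'.1, half d'.2) (ε * (real5 r.1 / 4))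
        (ε * (real5 r.2.1 / 4)) (ε * (real5 r.2.2 / 4)) := by
    rcases exists_matches d hd d' hd' with rfl | ⟨r, hr, h | h⟩
    · exact absurd (by rcases hed with rfl | rfl <;> rcases hed' with rfl | rfl <;>
        simp [Sym2.eq_swap]) hne
    · exact ⟨r, hr, 1, by norm_num, by simpa using hasProducts_of_matches h⟩
    · refine ⟨r, hr, -1, by norm_num, ?_⟩
      have := hasProducts_of_matches h
      simpa [neg_div] using this
  obtain ⟨r, hr, ε, hε, H⟩ := base
  rcases hed with rfl | rfl <;> rcases hed' with rfl | rfl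
  · exact ⟨r, hr, ε, hε, H⟩
  · exact ⟨r, hr, -ε, by rw [neg_sq, hε], by simpa only [neg_mul, Prod.swap] using H.swap_right⟩
  · exact ⟨r, hr, -ε, by rw [neg_sq, hε], by simpa only [neg_mul, Prod.swap] using H.swap_left⟩
  · exact ⟨r, hr, ε, hε, by simpa only [neg_neg, Prod.swap] using H.swap_left.swap_right⟩

/-! ### The minimal distance and the cylinders -/

theorem minDist_le_setDist {δ : ℝ} {e e' : E3 × E3} (h : AreDistinctEdges e e') :
    minDist δ ≤ setDist (tangentLine δ e) (tangentLine δ e') :=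
  csInf_le ⟨0, by rintro _ ⟨e, e', -, rfl⟩; exact setDist_nonneg _ _⟩ ⟨e, e', h, rfl⟩

theorem minDist_nonneg (δ : ℝ) : 0 ≤ minDist δ := by
  refine Real.sInf_nonneg ?_
  rintro _ ⟨e, e', -, rfl⟩
  exact setDist_nonneg _ _

theorem mem_cylinderAxis_iff {r δ : ℝ} (hr : 0 < r) {e : E3 × E3} {z : E3} :
    z ∈ cylinderAxis r δ e ↔ ∃ x ∈ tangentLine δ e, z = (1 + r) • x := by
  have h0 : 1 + r ≠ 0 := by positivity
  constructor
  · rintro ⟨t, rfl⟩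
    refine ⟨_, ⟨(1 + r)⁻¹ * t, rfl⟩, ?_⟩
    rw [smul_add, smul_smul, mul_inv_cancel_left₀ h0]
  · rintro ⟨_, ⟨t, rfl⟩, rfl⟩
    exact ⟨(1 + r) * t, by rw [smul_add, smul_smul]⟩

theorem cylinderAxis_nonempty (r δ : ℝ) (e : E3 × E3) : (cylinderAxis r δ e).Nonempty :=
  ⟨_, 0, rfl⟩

/-- The axes of two cylinders have distance at least `(1 + r) d`, where `d` is the minimal distance
of the rulings. -/
theorem lt_add_of_infDist_lt {r δ a b : ℝ} (hr : 0 < r) {e e' : E3 × E3}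
    (h : AreDistinctEdges e e') {z : E3} (ha : Metric.infDist z (cylinderAxis r δ e) < a)
    (hb : Metric.infDist z (cylinderAxis r δ e') < b) : (1 + r) * minDist δ < a + b := by
  obtain ⟨X, hX, hXa⟩ := (Metric.infDist_lt_iff (cylinderAxis_nonempty r δ e)).1 ha
  obtain ⟨Y, hY, hYb⟩ := (Metric.infDist_lt_iff (cylinderAxis_nonempty r δ e')).1 hb
  obtain ⟨x, hx, rfl⟩ := (mem_cylinderAxis_iff hr).1 hX
  obtain ⟨y, hy, rfl⟩ := (mem_cylinderAxis_iff hr).1 hY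
  have h1 : minDist δ ≤ dist x y := (minDist_le_setDist h).trans (setDist_le_dist hx hy)
  have h2 : dist ((1 + r) • x) ((1 + r) • y) = (1 + r) * dist x y := by
    rw [dist_smul₀, Real.norm_of_nonneg (by positivity)]
  have h3 := dist_triangle_left ((1 + r) • x) ((1 + r) • y) z
  calc (1 + r) * minDist δ ≤ (1 + r) * dist x y := by gcongr
    _ < a + b := by linarith

/-- If the minimal distance `d` is attained, cylinders of radius `r` form a compound exactly when
the smallest distance `(1 + r) d` of their axes is `2 r`. -/
theorem isCompoundRadius_iff {δ : ℝ} (h0 : 0 < minDist δ) (h2 : minDist δ < 2)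
    (hatt : ∃ e e', AreDistinctEdges e e' ∧ ∃ x ∈ tangentLine δ e, ∃ y ∈ tangentLine δ e',
      dist x y = minDist δ) (r : ℝ) :
    IsCompoundRadius δ r ↔ r = minDist δ / (2 - minDist δ) := by
  have heq : r = minDist δ / (2 - minDist δ) ↔ (1 + r) * minDist δ = 2 * r := by
    rw [eq_div_iff (by linarith)]
    constructor <;> intro h <;> linarith
  obtain ⟨e, e', hee', x, hx, y, hy, hxy⟩ := hatt
  -- the point halfway between the two axes is on both cylinders when these touch
  have mid : 0 < r → ∃ z, Metric.infDist z (cylinderAxis r δ e) ≤ (1 + r) * minDist δ / 2 ∧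
      Metric.infDist z (cylinderAxis r δ e') ≤ (1 + r) * minDist δ / 2 := by
    intro hr
    have hd : dist ((1 + r) • x) ((1 + r) • y) = (1 + r) * minDist δ := by
      rw [dist_smul₀, Real.norm_of_nonneg (by positivity), hxy]
    refine ⟨midpoint ℝ ((1 + r) • x) ((1 + r) • y),
      (Metric.infDist_le_dist_of_mem ((mem_cylinderAxis_iff hr).2 ⟨x, hx, rfl⟩)).trans_eq ?_,
      (Metric.infDist_le_dist_of_mem ((mem_cylinderAxis_iff hr).2 ⟨y, hy, rfl⟩)).trans_eq ?_⟩
    · rw [dist_midpoint_left, hd, Real.norm_of_nonneg (by norm_num)]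
      ring
    · rw [dist_midpoint_right, hd, Real.norm_of_nonneg (by norm_num)]
      ring
  rw [heq]
  constructor
  · rintro ⟨hr, hdisj, f, f', hff', z, hz, hz'⟩
    apply le_antisymm
    · refine le_of_forall_pos_lt_add fun ε hε => ?_
      have := lt_add_of_infDist_lt hr hff' (a := r + ε / 2) (b := r + ε / 2)
        (lt_of_le_of_lt hz (by linarith)) (lt_of_le_of_lt hz' (by linarith))
      linarith
    · by_contra! hlt
      obtain ⟨z, hz, hz'⟩ := mid hr
      exact Set.disjoint_left.1 (hdisj e e' hee')
        (show Metric.infDist z _ < r by linarith) (show Metric.infDist z _ < r by linarith)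
  · intro h
    have hr : 0 < r := by nlinarith
    refine ⟨hr, fun f f' hff' => Set.disjoint_left.2 fun z hz hz' => ?_, e, e', hee', ?_⟩
    · have := lt_add_of_infDist_lt hr hff' hz hz'
      linarith
    · obtain ⟨z, hz, hz'⟩ := mid hr
      exact ⟨z, show Metric.infDist z _ ≤ r by linarith, show Metric.infDist z _ ≤ r by linarith⟩

/-! ### Two kinds of pairs of edges -/

theorem isEdge_of_norm_sq {x y : E3} (hx : x ∈ icosahedronVertices) (hy : y ∈ icosahedronVertices)
    (h : ‖x - y‖ ^ 2 = (2 * goldenRatio⁻¹) ^ 2) : IsEdge (x, y) := by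
  refine ⟨hx, hy, ?_⟩
  have hg := inv_goldenRatio_pos
  rw [dist_eq_norm, div_eq_mul_inv]
  exact (sq_eq_sq₀ (norm_nonneg _) (by positivity)).1 h

theorem areDistinctEdges_of_fst_ne {e e' : E3 × E3} (h : IsEdge e) (h' : IsEdge e')
    (h1 : e.1 ≠ e'.1) (h2 : e.1 ≠ e'.2) : AreDistinctEdges e e' := by
  refine ⟨h, h', fun h => ?_⟩
  rcases Sym2.eq_iff.1 h with h | h
  · exact h1 h.1
  · exact h2 h.1

/-- There are two edges with orthogonal middles whose directions are orthogonal as well. -/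
theorem exists_orthogonal_edges : ∃ e e', AreDistinctEdges e e' ∧ HasProducts e e' 0 0 (-1) := by
  have hg := inv_goldenRatio_sq
  have h1 : IsEdge (!₂[1, 0, -1 * goldenRatio⁻¹], !₂[1, 0, 1 * goldenRatio⁻¹]) := by
    refine isEdge_of_norm_sq ⟨-1, by simp, 1, by simp, Or.inr (Or.inl rfl)⟩
      ⟨1, by simp, 1, by simp, Or.inr (Or.inl rfl)⟩ ?_
    simp [norm_sq_eq_coord]
    ring
  have h2 : IsEdge (!₂[-1 * goldenRatio⁻¹, 1, 0], !₂[1 * goldenRatio⁻¹, 1, 0]) := by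
    refine isEdge_of_norm_sq ⟨-1, by simp, 1, by simp, Or.inr (Or.inr rfl)⟩
      ⟨1, by simp, 1, by simp, Or.inr (Or.inr rfl)⟩ ?_
    simp [norm_sq_eq_coord]
    ring
  refine ⟨_, _, areDistinctEdges_of_fst_ne h1 h2 (fun h => ?_) (fun h => ?_), ?_, ?_, ?_⟩
  · simpa using congrArg (fun x : E3 => x 1) h
  · simpa using congrArg (fun x : E3 => x 1) h
  · simp [inner_eq_coord]
  · simp [inner_eq_coord, turned, cross_coord_zero, cross_coord_one, cross_coord_two,
      edgeMiddle_coord]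
  · simp [inner_eq_coord, turned, cross_coord_zero, cross_coord_one, cross_coord_two,
      edgeMiddle_coord]
    ring

/-- Two edges of one face have the products `-1 / 2`, `-τ⁻¹ / 2` and `0`. -/
theorem exists_adjacent_edges :
    ∃ e e', AreDistinctEdges e e' ∧ HasProducts e e' (-(1 / 2)) (-(goldenRatio⁻¹ / 2)) 0 := by
  have hg := inv_goldenRatio_sq
  have hpos := inv_goldenRatio_pos
  have h1 : IsEdge (!₂[0, -1 * goldenRatio⁻¹, 1], !₂[0, 1 * goldenRatio⁻¹, 1]) := by
    refine isEdge_of_norm_sq ⟨-1, by simp, 1, by simp, Or.inl rfl⟩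
      ⟨1, by simp, 1, by simp, Or.inl rfl⟩ ?_
    simp [norm_sq_eq_coord]
    ring
  have h2 : IsEdge (!₂[0, 1 * goldenRatio⁻¹, 1], !₂[1, 0, 1 * goldenRatio⁻¹]) := by
    refine isEdge_of_norm_sq ⟨1, by simp, 1, by simp, Or.inl rfl⟩
      ⟨1, by simp, 1, by simp, Or.inr (Or.inl rfl)⟩ ?_
    simp only [norm_sq_eq_coord, PiLp.sub_apply, Matrix.cons_val]
    linear_combination -2 * hg
  refine ⟨_, _, areDistinctEdges_of_fst_ne h1 h2 (fun h => ?_) (fun h => ?_), ?_, ?_, ?_⟩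
  · have := congrArg (fun x : E3 => x 1) h
    simp only [Matrix.cons_val] at this
    linarith
  · simpa using congrArg (fun x : E3 => x 0) h
  all_goals
    simp only [inner_eq_coord, turned, cross_coord_zero, cross_coord_one, cross_coord_two,
      edgeMiddle_coord, PiLp.sub_apply, Matrix.cons_val]
    ring

/-! ### The critical polynomial -/

theorem sqrt_five_bounds : 2.23606797749 < √5 ∧ √5 < 2.2360679775 :=
  ⟨Real.lt_sqrt_of_sq_lt (by norm_num), (Real.sqrt_lt' (by norm_num)).2 (by norm_num)⟩

theorem inv_goldenRatio_bounds :
    0.618033988745 < goldenRatio⁻¹ ∧ goldenRatio⁻¹ < 0.61803398875 := by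
  rw [inv_goldenRatio_eq_sqrt]
  obtain ⟨h1, h2⟩ := sqrt_five_bounds
  constructor <;> linarith

theorem aeval_criticalPoly {A : Type*} [CommRing A] (t : A) :
    aeval t criticalPoly = 5 * t ^ 6 - 80 * t ^ 5 + 190 * t ^ 3 - 4 * t ^ 2 - 84 * t + 9 := by
  simp only [criticalPoly, map_add, map_sub, map_mul, map_pow, map_ofNat, aeval_X]

/-- The critical polynomial has a sign change in six disjoint intervals, which account for all of
its roots. -/
theorem im_eq_zero_of_aeval_criticalPoly {z : ℂ} (hz : aeval z criticalPoly = 0) : z.im = 0 := by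
  set f : ℝ → ℝ := fun t => aeval t criticalPoly with hf
  have hcont : Continuous f := by
    simp only [hf, aeval_criticalPoly]
    fun_prop
  have up : ∀ a b : ℝ, a ≤ b → f a < 0 → 0 < f b → ∃ x, a < x ∧ x < b ∧ f x = 0 :=
    fun a b hab ha hb => by
      obtain ⟨x, hx, h0⟩ := intermediate_value_Ioo hab hcont.continuousOn ⟨ha, hb⟩
      exact ⟨x, hx.1, hx.2, h0⟩
  have down : ∀ a b : ℝ, a ≤ b → 0 < f a → f b < 0 → ∃ x, a < x ∧ x < b ∧ f x = 0 :=
    fun a b hab ha hb => by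
      obtain ⟨x, hx, h0⟩ := intermediate_value_Ioo' hab hcont.continuousOn ⟨hb, ha⟩
      exact ⟨x, hx.1, hx.2, h0⟩
  have v0 : 0 < f (-2) := by simp only [hf, aeval_criticalPoly]; norm_num
  have v1 : f (-1) < 0 := by simp only [hf, aeval_criticalPoly]; norm_num
  have v2 : 0 < f 0 := by simp only [hf, aeval_criticalPoly]; norm_num
  have v3 : f (1 / 2) < 0 := by simp only [hf, aeval_criticalPoly]; norm_num
  have v4 : 0 < f 1 := by simp only [hf, aeval_criticalPoly]; norm_num
  have v5 : f 2 < 0 := by simp only [hf, aeval_criticalPoly]; norm_num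
  have v6 : 0 < f 16 := by simp only [hf, aeval_criticalPoly]; norm_num
  obtain ⟨x1, a1, b1, h1⟩ := down _ _ (by norm_num) v0 v1
  obtain ⟨x2, a2, b2, h2⟩ := up _ _ (by norm_num) v1 v2
  obtain ⟨x3, a3, b3, h3⟩ := down _ _ (by norm_num) v2 v3
  obtain ⟨x4, a4, b4, h4⟩ := up _ _ (by norm_num) v3 v4
  obtain ⟨x5, a5, b5, h5⟩ := down _ _ (by norm_num) v4 v5
  obtain ⟨x6, a6, b6, h6⟩ := up _ _ (by norm_num) v5 v6
  set p : ℂ[X] := criticalPoly.map (Int.castRingHom ℂ) with hp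
  have hpeval : ∀ w : ℂ, p.eval w = aeval w criticalPoly := fun w => by
    rw [hp, eval_map, aeval_def]
    rfl
  have hdeg : p.natDegree ≤ 6 := by
    refine (natDegree_map_le).trans ?_
    rw [criticalPoly]
    compute_degree
  have hp0 : p ≠ 0 := by
    intro h0
    have h := hpeval 0
    rw [h0, aeval_criticalPoly] at h
    norm_num at h
  have hroot : ∀ x : ℝ, f x = 0 → (x : ℂ) ∈ p.roots.toFinset := by
    intro x hx
    rw [Multiset.mem_toFinset, mem_roots hp0, IsRoot.def, hpeval, aeval_criticalPoly]
    simp only [hf, aeval_criticalPoly] at hx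
    exact_mod_cast hx
  set S : Finset ℝ := {x1, x2, x3, x4, x5, x6} with hS
  have hScard : S.card = 6 := by
    rw [hS]
    repeat rw [Finset.card_insert_of_notMem (by
      simp only [Finset.mem_insert, Finset.mem_singleton, not_or]
      refine ⟨?_, ?_⟩ <;> (try constructorm* _ ∧ _) <;> exact ne_of_lt (by linarith))]
    rw [Finset.card_pair (ne_of_lt (by linarith))]
  have hsub : S.image (fun x : ℝ => (x : ℂ)) ⊆ p.roots.toFinset := by
    intro w hw
    obtain ⟨x, hx, rfl⟩ := Finset.mem_image.1 hw
    simp only [hS, Finset.mem_insert, Finset.mem_singleton] at hx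
    apply hroot
    rcases hx with rfl | rfl | rfl | rfl | rfl | rfl <;> assumption
  have hcard : (S.image (fun x : ℝ => (x : ℂ))).card = 6 := by
    rw [Finset.card_image_of_injective _ Complex.ofReal_injective, hScard]
  have hle : p.roots.toFinset.card ≤ (S.image (fun x : ℝ => (x : ℂ))).card := by
    rw [hcard]
    exact (Multiset.toFinset_card_le _).trans ((card_roots' p).trans hdeg)
  have hz' : z ∈ S.image (fun x : ℝ => (x : ℂ)) := by
    rw [Finset.eq_of_subset_of_card_le hsub hle, Multiset.mem_toFinset, mem_roots hp0, IsRoot.def,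
      hpeval, hz]
  obtain ⟨x, -, rfl⟩ := Finset.mem_image.1 hz'
  exact Complex.ofReal_im x

/-- The cubic factor over `ℚ(√5)` of the critical polynomial which vanishes at the square of the
tangent of the optimal angle. -/
def criticalCubic (t : ℝ) : ℝ :=
  (3 + goldenRatio⁻¹) * t ^ 3 + (-9 + 7 * goldenRatio⁻¹) * t ^ 2
    + (-9 + 10 * goldenRatio⁻¹) * t + 3

theorem aeval_criticalPoly_eq_zero {t : ℝ} (h : criticalCubic t = 0) :
    aeval t criticalPoly = 0 := by
  rw [aeval_criticalPoly]
  have hg := inv_goldenRatio_sq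
  rw [criticalCubic] at h
  generalize goldenRatio⁻¹ = g at *
  -- the other factor arises from the conjugation `g ↦ -1 - g`
  linear_combination ((2 - g) * t ^ 3 + (-16 - 7 * g) * t ^ 2 + (-19 - 10 * g) * t + 3) * h
    + (t ^ 3 + 7 * t ^ 2 + 10 * t) ^ 2 * hg

theorem exists_criticalCubic_eq_zero :
    ∃ t, 0.694355839 ≤ t ∧ t ≤ 0.694355840 ∧ criticalCubic t = 0 := by
  have hcont : Continuous criticalCubic := by
    unfold criticalCubic
    fun_prop
  obtain ⟨h1, h2⟩ := inv_goldenRatio_bounds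
  obtain ⟨t, ht, h0⟩ := intermediate_value_Icc' (a := (0.694355839 : ℝ)) (b := 0.694355840)
    (by norm_num) hcont.continuousOn (show (0 : ℝ) ∈ _ from
      ⟨by rw [criticalCubic]; norm_num at *; linarith,
        by rw [criticalCubic]; norm_num at *; linarith⟩)
  exact ⟨t, ht.1, ht.2, h0⟩

/-! ### The two distance functions -/

/-- The square of the distance of the lines of two orthogonal edges, `t` being the square of the
tangent of the angle. -/
def orthogonalDistSq (t : ℝ) : ℝ := (1 - t) ^ 2 / (1 + t + t ^ 2)

/-- The square of the distance of the lines of two edges of one face, `t` being the square of the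
tangent of the angle. -/
def adjacentDistSq (t : ℝ) : ℝ :=
  (1 - goldenRatio⁻¹) ^ 2 * t / ((1 + t) ^ 2 - (1 / 2 + goldenRatio⁻¹ / 2 * t) ^ 2)

theorem adjacent_denom_pos {t : ℝ} (ht : 0 ≤ t) :
    0 < (1 + t) ^ 2 - (1 / 2 + goldenRatio⁻¹ / 2 * t) ^ 2 := by
  obtain ⟨h1, h2⟩ := inv_goldenRatio_bounds
  have : goldenRatio⁻¹ * t ≤ t := mul_le_of_le_one_left ht (by linarith)
  have : 0 ≤ goldenRatio⁻¹ * t := mul_nonneg (by linarith) ht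
  rw [sub_pos]
  exact pow_lt_pow_left₀ (by linarith) (by linarith) two_ne_zero

/-- The distances of the two kinds of pairs agree at the root of the cubic. -/
theorem adjacentDistSq_eq {t : ℝ} (h0 : 0 ≤ t) (h : criticalCubic t = 0) :
    adjacentDistSq t = orthogonalDistSq t := by
  rw [adjacentDistSq, orthogonalDistSq, div_eq_div_iff (adjacent_denom_pos h0).ne'
    (by positivity)]
  have hg := inv_goldenRatio_sq
  rw [criticalCubic] at h
  generalize goldenRatio⁻¹ = g at *
  linear_combination -(t + 1) / 4 * h
    + ((1 - t) ^ 2 * t ^ 2 + 4 * t * (1 + t + t ^ 2)) / 4 * hg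

/-- `orthogonalDistSq` is an increasing function of `t + 1 / t`, which is smaller strictly between
`s` and `1 / s` than at `s`. -/
theorem orthogonalDistSq_lt {s t : ℝ} (hs : 0 < s) (hst : s < t) (h : s * t < 1) :
    orthogonalDistSq t < orthogonalDistSq s := by
  have ht : 0 < t := hs.trans hst
  rw [orthogonalDistSq, orthogonalDistSq, div_lt_div_iff₀ (by positivity) (by positivity)]
  nlinarith [mul_pos (sub_pos.2 hst) (sub_pos.2 h)]

/-- As a function of `t`, `adjacentDistSq` is a multiple of the reciprocal of
`(4 - τ⁻²) t + (8 - 2 τ⁻¹) + 3 / t`, so that the comparison of two values factors as in `h`. -/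
theorem adjacentDistSq_lt_of_sign {s t : ℝ} (hs : 0 < s) (ht : 0 ≤ t)
    (h : 0 < (s - t) * (3 - (4 - goldenRatio⁻¹ ^ 2) * (s * t))) :
    adjacentDistSq t < adjacentDistSq s := by
  have hg : 0 < (1 - goldenRatio⁻¹) ^ 2 := by
    obtain ⟨h1, h2⟩ := inv_goldenRatio_bounds
    exact pow_pos (by linarith) 2
  rw [adjacentDistSq, adjacentDistSq, div_lt_div_iff₀ (adjacent_denom_pos ht)
    (adjacent_denom_pos hs.le), mul_assoc, mul_assoc]
  refine mul_lt_mul_of_pos_left ?_ hg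
  linear_combination h / 4

theorem adjacentDistSq_lt_of_lt {s t : ℝ} (hs : 0 < s) (hs' : s < 0.7) (ht : 0 ≤ t) (hts : t < s) :
    adjacentDistSq t < adjacentDistSq s := by
  refine adjacentDistSq_lt_of_sign hs ht (mul_pos (by linarith) ?_)
  nlinarith [mul_nonneg hs.le ht, mul_nonneg (sq_nonneg goldenRatio⁻¹) (mul_nonneg hs.le ht)]

theorem adjacentDistSq_lt_of_one_le_mul {s t : ℝ} (hs : 0 < s) (hs' : s < 1) (h : 1 ≤ s * t) :
    adjacentDistSq t < adjacentDistSq s := by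
  have hst : s < t := by
    by_contra! hts
    nlinarith
  refine adjacentDistSq_lt_of_sign hs (hs.trans hst).le (mul_pos_of_neg_of_neg (by linarith) ?_)
  obtain ⟨h1, h2⟩ := inv_goldenRatio_bounds
  nlinarith [inv_goldenRatio_sq]

theorem mixedVolume_eq {α β σ δ : ℝ} (hc : cos δ ≠ 0) :
    mixedVolume α β σ δ = cos δ ^ 2 * (σ * (1 - tan δ ^ 2) + 2 * (β - α) * tan δ) := by
  rw [mixedVolume, tan_eq_sin_div_cos]
  field_simp

theorem sinSqAngle_eq {α β σ δ : ℝ} (hc : cos δ ≠ 0) :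
    sinSqAngle α β σ δ = cos δ ^ 4 *
      ((1 + tan δ ^ 2) ^ 2 - (α + β * tan δ ^ 2 + σ * tan δ) ^ 2) := by
  have h : cos δ ^ 4 * (1 + tan δ ^ 2) ^ 2 = 1 := by
    rw [tan_eq_sin_div_cos]
    field_simp
    rw [cos_sq_add_sin_sq, one_pow]
  rw [mul_sub, h, sinSqAngle, tan_eq_sin_div_cos]
  field_simp

theorem HasProducts.setDist_sq_eq {e e' : E3 × E3} {α β σ : ℝ} (H : HasProducts e e' α β σ)
    (h : IsEdge e) (h' : IsEdge e') {δ : ℝ} (hc : cos δ ≠ 0)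
    (hpos : 0 < (1 + tan δ ^ 2) ^ 2 - (α + β * tan δ ^ 2 + σ * tan δ) ^ 2) :
    setDist (tangentLine δ e) (tangentLine δ e') ^ 2
      = (σ * (1 - tan δ ^ 2) + 2 * (β - α) * tan δ) ^ 2 /
        ((1 + tan δ ^ 2) ^ 2 - (α + β * tan δ ^ 2 + σ * tan δ) ^ 2) := by
  have hc4 : 0 < cos δ ^ 4 := by positivity
  rw [H.setDist_sq h h' (by rw [sinSqAngle_eq hc]; positivity), sinSqAngle_eq hc,
    mixedVolume_eq hc, mul_pow, ← pow_mul, mul_div_mul_left _ _ hc4.ne']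

theorem minDist_sq_le_orthogonalDistSq {δ : ℝ} (hc : cos δ ≠ 0) :
    minDist δ ^ 2 ≤ orthogonalDistSq (tan δ ^ 2) := by
  obtain ⟨e, e', h, H⟩ := exists_orthogonal_edges
  refine (pow_le_pow_left₀ (minDist_nonneg δ) (minDist_le_setDist h) 2).trans_eq ?_
  rw [H.setDist_sq_eq h.1 h.2.1 hc (by nlinarith [sq_nonneg (tan δ)]), orthogonalDistSq]
  congr 1 <;> ring

theorem minDist_sq_le_adjacentDistSq {δ : ℝ} (hc : cos δ ≠ 0) :
    minDist δ ^ 2 ≤ adjacentDistSq (tan δ ^ 2) := by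
  obtain ⟨e, e', h, H⟩ := exists_adjacent_edges
  refine (pow_le_pow_left₀ (minDist_nonneg δ) (minDist_le_setDist h) 2).trans_eq ?_
  have hpos := adjacent_denom_pos (sq_nonneg (tan δ))
  rw [H.setDist_sq_eq h.1 h.2.1 hc (by convert hpos using 1; ring), adjacentDistSq]
  congr 1 <;> ring

theorem minDist_eq_zero_of_cos_eq_zero {δ : ℝ} (hc : cos δ = 0) : minDist δ = 0 := by
  obtain ⟨e, e', h, H⟩ := exists_adjacent_edges
  have hs : sin δ ^ 2 = 1 := by rw [sin_sq, hc]; norm_num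
  have hpos : 0 < sinSqAngle (-(1 / 2)) (-(goldenRatio⁻¹ / 2)) 0 δ := by
    rw [sinSqAngle, hc, hs]
    have := inv_goldenRatio_bounds
    nlinarith
  have h0 : setDist (tangentLine δ e) (tangentLine δ e') ^ 2 = 0 := by
    rw [H.setDist_sq h.1 h.2.1 hpos, mixedVolume, hc]
    simp
  exact le_antisymm ((minDist_le_setDist h).trans_eq (pow_eq_zero_iff two_ne_zero |>.1 h0))
    (minDist_nonneg δ)

/-! ### The optimal angle -/

/-- A pair of edges whose direction sine and mixed volume are controlled as follows is farther
apart than the two critical pairs. -/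
theorem dist_bound_of_bounds {D t x v : ℝ} (hD : D ≤ 0.043) (ht : 0.6943 ≤ t)
    (ht' : t ≤ 0.6944) (hx : -1.69 ≤ x) (hx' : x ≤ 1.69) (hv : 0.36 ≤ v ∨ v ≤ -0.36) :
    0 < (1 + t) ^ 2 - x ^ 2 ∧ D * ((1 + t) ^ 2 - x ^ 2) ≤ v ^ 2 := by
  have hv2 : 0.1296 ≤ v ^ 2 := by rcases hv with h | h <;> nlinarith
  have h1 : 0 < (1 + t) ^ 2 - x ^ 2 := by nlinarith
  refine ⟨h1, ?_⟩
  calc D * ((1 + t) ^ 2 - x ^ 2) ≤ 0.043 * (1.6944 ^ 2) := by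
        apply mul_le_mul hD _ h1.le (by norm_num)
        nlinarith [sq_nonneg x]
    _ ≤ v ^ 2 := by linarith

/-- A pair of lines that are almost parallel, so that its sine is small. -/
theorem dist_bound_of_almost_parallel {D t x v : ℝ} (hD : D ≤ 0.043) (ht : 0.6943 ≤ t)
    (ht' : t ≤ 0.6944) (hx : 1.66 ≤ x) (hx' : x ≤ 1.69) (hv : v ≤ -0.3) :
    0 < (1 + t) ^ 2 - x ^ 2 ∧ D * ((1 + t) ^ 2 - x ^ 2) ≤ v ^ 2 := by
  have hv2 : 0.09 ≤ v ^ 2 := by nlinarith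
  have h1 : 0 < (1 + t) ^ 2 - x ^ 2 := by nlinarith
  refine ⟨h1, ?_⟩
  calc D * ((1 + t) ^ 2 - x ^ 2) ≤ 0.043 * 0.2 := by
        apply mul_le_mul hD _ h1.le (by norm_num)
        nlinarith
    _ ≤ v ^ 2 := by linarith

/-- At the optimal angle no pair of edges in the table is closer than the two critical ones. -/
theorem productTable_bound {D t T : ℝ} (hT0 : 0 ≤ T) (hT : T ^ 2 = t)
    (ht : 0.694355839 ≤ t) (ht' : t ≤ 0.694355840) (hD : D ≤ 0.043)
    (h1 : D * ((1 + t) ^ 2 - t) = (1 - t) ^ 2)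
    (h2 : D * ((1 + t) ^ 2 - (1 / 2 + goldenRatio⁻¹ / 2 * t) ^ 2)
      = (1 - goldenRatio⁻¹) ^ 2 * t) :
    ∀ r ∈ productTable,
      0 < (1 + t) ^ 2 - (real5 r.1 / 4 + real5 r.2.1 / 4 * t + real5 r.2.2 / 4 * T) ^ 2 ∧
      D * ((1 + t) ^ 2 - (real5 r.1 / 4 + real5 r.2.1 / 4 * t + real5 r.2.2 / 4 * T) ^ 2)
        ≤ (real5 r.2.2 / 4 * (1 - t) + 2 * (real5 r.2.1 / 4 - real5 r.1 / 4) * T) ^ 2 := by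
  have hTl : 0.8332 ≤ T :=
    (pow_le_pow_iff_left₀ (by norm_num) hT0 two_ne_zero).1
      (by rw [hT]; norm_num; linarith only [ht])
  have hTu : T ≤ 0.8333 :=
    (pow_le_pow_iff_left₀ hT0 (by norm_num) two_ne_zero).1
      (by rw [hT]; norm_num; linarith only [ht'])
  obtain ⟨hrl, hru⟩ := sqrt_five_bounds
  have hrTl : 2.236 * T ≤ √5 * T := by gcongr; linarith
  have hrTu : √5 * T ≤ 2.2361 * T := by gcongr; linarith
  have hrtl : 2.236 * t ≤ √5 * t := by gcongr; linarith
  have hrtu : √5 * t ≤ 2.2361 * t := by gcongr; linarith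
  have htl : (0.6943 : ℝ) ≤ t := by linarith
  have htu : t ≤ 0.6944 := by linarith
  intro r hr
  simp only [productTable, List.mem_cons, List.not_mem_nil, or_false] at hr
  rcases hr with rfl | rfl | rfl | rfl | rfl | rfl | rfl | rfl | rfl | rfl | rfl <;>
    simp only [real5_mk, map_zero, map_ofNat, map_neg] <;> push_cast
  · have e : (0 / 4 + 0 / 4 * t + 4 / 4 * T) ^ 2 = t := by rw [← hT]; ring
    rw [e, h1]
    exact ⟨by linarith only [sq_nonneg t, htl], by ring_nf; rfl⟩
  · have e : 2 / 4 + (-1 + 1 * √5) / 4 * t + 0 / 4 * T = 1 / 2 + goldenRatio⁻¹ / 2 * t := by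
      rw [inv_goldenRatio_eq_sqrt]; ring
    rw [e, h2]
    refine ⟨adjacent_denom_pos (by linarith), le_of_eq ?_⟩
    rw [inv_goldenRatio_eq_sqrt, ← hT]
    ring
  all_goals clear h1 h2 hT hT0 ht ht'
  · exact dist_bound_of_bounds hD htl htu (by linarith) (by linarith) (Or.inr (by linarith))
  · exact dist_bound_of_almost_parallel hD htl htu (by linarith) (by linarith) (by linarith)
  · exact dist_bound_of_bounds hD htl htu (by linarith) (by linarith) (Or.inr (by linarith))
  · exact dist_bound_of_bounds hD htl htu (by linarith) (by linarith) (Or.inr (by linarith))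
  · exact dist_bound_of_bounds hD htl htu (by linarith) (by linarith) (Or.inr (by linarith))
  · exact dist_bound_of_bounds hD htl htu (by linarith) (by linarith) (Or.inr (by linarith))
  · exact dist_bound_of_bounds hD htl htu (by linarith) (by linarith) (Or.inl (by linarith))
  · exact dist_bound_of_bounds hD htl htu (by linarith) (by linarith) (Or.inr (by linarith))
  · exact dist_bound_of_bounds hD htl htu (by linarith) (by linarith) (Or.inr (by linarith))

theorem arctan_le_of_nonneg {x : ℝ} (hx : 0 ≤ x) : arctan x ≤ x - x ^ 3 / 3 + x ^ 5 / 5 := by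
  have hmono : Monotone fun x : ℝ => x - x ^ 3 / 3 + x ^ 5 / 5 - arctan x := by
    have hd : ∀ x : ℝ, HasDerivAt (fun x : ℝ => x - x ^ 3 / 3 + x ^ 5 / 5 - arctan x)
        (x ^ 6 / (1 + x ^ 2)) x := by
      intro x
      have h := ((((hasDerivAt_id x).sub ((hasDerivAt_pow 3 x).div_const 3)).add
        ((hasDerivAt_pow 5 x).div_const 5)).sub (hasDerivAt_arctan x))
      refine h.congr_deriv ?_
      have : 1 + x ^ 2 ≠ 0 := by positivity
      field_simp
      ring
    refine monotone_of_deriv_nonneg (fun x => (hd x).differentiableAt) fun x => ?_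
    rw [(hd x).deriv]
    positivity
  simpa using hmono hx

theorem le_arctan_of_nonneg {x : ℝ} (hx : 0 ≤ x) :
    x - x ^ 3 / 3 + x ^ 5 / 5 - x ^ 7 / 7 ≤ arctan x := by
  have hmono : Monotone fun x : ℝ => arctan x - (x - x ^ 3 / 3 + x ^ 5 / 5 - x ^ 7 / 7) := by
    have hd : ∀ x : ℝ, HasDerivAt
        (fun x : ℝ => arctan x - (x - x ^ 3 / 3 + x ^ 5 / 5 - x ^ 7 / 7))
        (x ^ 8 / (1 + x ^ 2)) x := by
      intro x
      have h := (hasDerivAt_arctan x).sub ((((hasDerivAt_id x).sub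
        ((hasDerivAt_pow 3 x).div_const 3)).add ((hasDerivAt_pow 5 x).div_const 5)).sub
        ((hasDerivAt_pow 7 x).div_const 7))
      refine h.congr_deriv ?_
      have : 1 + x ^ 2 ≠ 0 := by positivity
      field_simp
      ring
    refine monotone_of_deriv_nonneg (fun x => (hd x).differentiableAt) fun x => ?_
    rw [(hd x).deriv]
    positivity
  simpa using hmono hx

/-- The angle is close to `π / 4`; the difference to `π / 4` is evaluated by the arctangent
series. -/
theorem abs_arctan_sub_le {T : ℝ} (h1 : 0.83328 ≤ T) (h2 : T ≤ 0.8332804) :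
    |arctan T - 0.694707| ≤ 0.0000005 := by
  have hy : arctan T + arctan ((1 - T) / (1 + T)) = π / 4 := by
    have h0 : 1 + T ≠ 0 := by linarith
    rw [arctan_add, ← arctan_one]
    · congr 1
      rw [div_eq_one_iff_eq]
      · field_simp; ring
      · have : 1 - T * ((1 - T) / (1 + T)) = (1 + T ^ 2) / (1 + T) := by field_simp; ring
        rw [this]
        positivity
    · rw [← mul_div_assoc, div_lt_one (by linarith)]
      nlinarith
  have hl : (0.0909404 : ℝ) ≤ (1 - T) / (1 + T) := by
    rw [le_div_iff₀ (by linarith)]; linarith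
  have hu : (1 - T) / (1 + T) ≤ 0.0909409 := by
    rw [div_le_iff₀ (by linarith)]; linarith
  have h3 := (le_arctan_of_nonneg (x := 0.0909404) (by norm_num)).trans (arctan_mono hl)
  have h4 := (arctan_mono hu).trans (arctan_le_of_nonneg (by norm_num))
  have h5 := pi_gt_d6
  have h6 := pi_lt_d6
  norm_num at h3 h4
  rw [abs_le]
  constructor <;> linarith

/-- The two critical distances are equal at the optimal angle and are the smallest ones. -/
theorem minDist_arctan {t : ℝ} (ht : 0.694355839 ≤ t) (ht' : t ≤ 0.694355840)
    (h0 : criticalCubic t = 0) :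
    minDist (arctan √t) ^ 2 = orthogonalDistSq t ∧
    ∃ e e', AreDistinctEdges e e' ∧ ∃ x ∈ tangentLine (arctan √t) e,
      ∃ y ∈ tangentLine (arctan √t) e', dist x y = minDist (arctan √t) := by
  have htpos : 0 < t := by linarith
  have hc : cos (arctan √t) ≠ 0 := (cos_arctan_pos _).ne'
  have hT : √t ^ 2 = t := Real.sq_sqrt htpos.le
  have hup := minDist_sq_le_orthogonalDistSq hc
  rw [tan_arctan, hT] at hup
  have hadj := adjacentDistSq_eq htpos.le h0
  have hDdef : orthogonalDistSq t * (1 + t + t ^ 2) = (1 - t) ^ 2 :=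
    div_mul_cancel₀ _ (by positivity)
  have hD : orthogonalDistSq t ≤ 0.043 := by
    rw [orthogonalDistSq, div_le_iff₀ (by positivity)]
    nlinarith
  have h2 : orthogonalDistSq t * ((1 + t) ^ 2 - (1 / 2 + goldenRatio⁻¹ / 2 * t) ^ 2)
      = (1 - goldenRatio⁻¹) ^ 2 * t := by
    rw [← hadj]
    exact div_mul_cancel₀ _ (adjacent_denom_pos htpos.le).ne'
  have htable := productTable_bound (Real.sqrt_nonneg t) hT ht ht' hD
    (by linear_combination hDdef) h2
  have hlow : ∀ e e', AreDistinctEdges e e' →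
      orthogonalDistSq t
        ≤ setDist (tangentLine (arctan √t) e) (tangentLine (arctan √t) e') ^ 2 := by
    intro e e' h
    obtain ⟨r, hr, ε, hε, H⟩ := h.exists_hasProducts
    obtain ⟨hpos, hle⟩ := htable r hr
    have e1 : (ε * (real5 r.1 / 4) + ε * (real5 r.2.1 / 4) * t + ε * (real5 r.2.2 / 4) * √t) ^ 2
        = (real5 r.1 / 4 + real5 r.2.1 / 4 * t + real5 r.2.2 / 4 * √t) ^ 2 := by
      linear_combination
        (real5 r.1 / 4 + real5 r.2.1 / 4 * t + real5 r.2.2 / 4 * √t) ^ 2 * hε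
    have e2 : (ε * (real5 r.2.2 / 4) * (1 - t)
        + 2 * (ε * (real5 r.2.1 / 4) - ε * (real5 r.1 / 4)) * √t) ^ 2
        = (real5 r.2.2 / 4 * (1 - t) + 2 * (real5 r.2.1 / 4 - real5 r.1 / 4) * √t) ^ 2 := by
      linear_combination
        (real5 r.2.2 / 4 * (1 - t) + 2 * (real5 r.2.1 / 4 - real5 r.1 / 4) * √t) ^ 2 * hε
    rw [H.setDist_sq_eq h.1 h.2.1 hc (by rw [tan_arctan, hT, e1]; exact hpos), tan_arctan, hT,
      e1, e2, le_div_iff₀ hpos]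
    exact hle
  obtain ⟨e, e', h, H⟩ := exists_orthogonal_edges
  have hpos : 0 < (1 + tan (arctan √t) ^ 2) ^ 2
      - (0 + 0 * tan (arctan √t) ^ 2 + -1 * tan (arctan √t)) ^ 2 := by
    nlinarith [sq_nonneg (tan (arctan √t))]
  have hpair : setDist (tangentLine (arctan √t) e) (tangentLine (arctan √t) e') ^ 2
      = orthogonalDistSq t := by
    rw [H.setDist_sq_eq h.1 h.2.1 hc hpos, tan_arctan, hT, orthogonalDistSq, zero_add, zero_mul,
      zero_add, mul_pow, hT]
    congr 1 <;> ring
  have hmin : minDist (arctan √t)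
      = setDist (tangentLine (arctan √t) e) (tangentLine (arctan √t) e') := by
    refine le_antisymm (minDist_le_setDist h) (le_csInf ⟨_, e, e', h, rfl⟩ ?_)
    rintro _ ⟨f, f', hf, rfl⟩
    refine (sq_le_sq₀ (setDist_nonneg _ _) (setDist_nonneg _ _)).1 ?_
    rw [hpair]
    exact hlow f f' hf
  refine ⟨by rw [hmin, hpair], e, e', h, ?_⟩
  rw [hmin]
  refine exists_dist_eq_setDist (H.cross_ne_zero h.1 h.2.1 ?_)
  rw [sinSqAngle_eq hc]
  have hc4 : 0 < cos (arctan √t) ^ 4 := by positivity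
  exact mul_pos hc4 hpos

/-- At every other angle one of the two critical pairs is closer. -/
theorem minDist_sq_lt {s δ : ℝ} (hs : 0.694355839 ≤ s) (hs' : s ≤ 0.694355840)
    (h0 : criticalCubic s = 0) (hδ : δ ∈ Set.Icc 0 (π / 2)) (hne : δ ≠ arctan √s) :
    minDist δ ^ 2 < orthogonalDistSq s := by
  have hspos : 0 < s := by linarith
  have hadj := adjacentDistSq_eq hspos.le h0
  rcases eq_or_lt_of_le hδ.2 with h | hlt
  · rw [minDist_eq_zero_of_cos_eq_zero (by rw [h, cos_pi_div_two]), orthogonalDistSq]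
    have : 0 < (1 - s) ^ 2 := pow_pos (by linarith) 2
    norm_num
    positivity
  have hc : 0 < cos δ := cos_pos_of_mem_Ioo ⟨by linarith [hδ.1, pi_pos], hlt⟩
  have htan : 0 ≤ tan δ := tan_nonneg_of_nonneg_of_le_pi_div_two hδ.1 hδ.2
  have hts : tan δ ^ 2 ≠ s := by
    rintro rfl
    rw [Real.sqrt_sq htan, arctan_tan (by linarith [hδ.1, pi_pos]) hlt] at hne
    exact hne rfl
  rcases lt_or_gt_of_ne hts with h | h
  · rw [← hadj]
    exact (minDist_sq_le_adjacentDistSq hc.ne').trans_lt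
      (adjacentDistSq_lt_of_lt hspos (by linarith) (sq_nonneg _) h)
  rcases lt_or_ge (s * tan δ ^ 2) 1 with h1 | h1
  · exact (minDist_sq_le_orthogonalDistSq hc.ne').trans_lt (orthogonalDistSq_lt hspos h h1)
  · rw [← hadj]
    exact (minDist_sq_le_adjacentDistSq hc.ne').trans_lt
      (adjacentDistSq_lt_of_one_le_mul hspos (by linarith) h1)

end PlatonicCompound

end

theorem theorem2 :
    -- all roots of the polynomial are real
    (∀ z : ℂ, Polynomial.aeval z PlatonicCompound.criticalPoly = 0 → z.im = 0) ∧
    ∃ t₀ δmax : ℝ,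
      Polynomial.aeval t₀ PlatonicCompound.criticalPoly = 0 ∧
      |t₀ - 0.694356| ≤ 0.0000005 ∧
      δmax = Real.arctan (Real.sqrt t₀) ∧
      |δmax - 0.694707| ≤ 0.0000005 ∧
      -- on `[0, π/2]` the minimal distance takes its maximum at `δmax`, and only there
      δmax ∈ Set.Icc 0 (Real.pi / 2) ∧
      (∀ δ ∈ Set.Icc 0 (Real.pi / 2), δ ≠ δmax →
        PlatonicCompound.minDist δ < PlatonicCompound.minDist δmax) ∧
      -- the square of the minimal distance at `δmax`
      |PlatonicCompound.minDist δmax ^ 2 - 0.0429216| ≤ 0.00000005 ∧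
      -- the radius of the corresponding compound of cylinders
      ∃ r : ℝ,
        (∀ s : ℝ, PlatonicCompound.IsCompoundRadius δmax s ↔ s = r) ∧
        r = PlatonicCompound.minDist δmax / (2 - PlatonicCompound.minDist δmax) ∧
        |r - 0.115558| ≤ 0.0000005 := by
  refine ⟨fun z => PlatonicCompound.im_eq_zero_of_aeval_criticalPoly, ?_⟩
  obtain ⟨t, ht, ht', h0⟩ := PlatonicCompound.exists_criticalCubic_eq_zero
  obtain ⟨hsq, hatt⟩ := PlatonicCompound.minDist_arctan ht ht' h0
  have hnn := PlatonicCompound.minDist_nonneg (arctan √t)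
  have hT : √t ^ 2 = t := Real.sq_sqrt (by linarith)
  have hTnn := Real.sqrt_nonneg t
  have hD1 : 0.042921643 ≤ PlatonicCompound.orthogonalDistSq t := by
    rw [PlatonicCompound.orthogonalDistSq, le_div_iff₀ (by positivity)]
    nlinarith
  have hD2 : PlatonicCompound.orthogonalDistSq t ≤ 0.042921646 := by
    rw [PlatonicCompound.orthogonalDistSq, div_le_iff₀ (by positivity)]
    nlinarith
  have hd1 : 0.207175 ≤ PlatonicCompound.minDist (arctan √t) := by nlinarith
  have hd2 : PlatonicCompound.minDist (arctan √t) ≤ 0.2071756 := by nlinarith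
  refine ⟨t, arctan √t, PlatonicCompound.aeval_criticalPoly_eq_zero h0, ?_, rfl,
    PlatonicCompound.abs_arctan_sub_le (by nlinarith) (by nlinarith),
    ⟨arctan_nonneg.2 hTnn, (arctan_lt_pi_div_two _).le⟩, ?_, ?_, _,
    PlatonicCompound.isCompoundRadius_iff (by linarith) (by linarith) hatt, rfl, ?_⟩
  · rw [abs_le]
    constructor <;> linarith
  · intro δ hδ hne
    refine lt_of_pow_lt_pow_left₀ 2 hnn ?_
    rw [hsq]
    exact PlatonicCompound.minDist_sq_lt ht ht' h0 hδ hne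
  · rw [hsq, abs_le]
    constructor <;> linarith
  · rw [abs_le]
    constructor
    · rw [le_sub_iff_add_le, le_div_iff₀ (by linarith)]
      linarith
    · rw [sub_le_iff_le_add, div_le_iff₀ (by linarith)]
      linarith
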